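/- Let $M$ be a smooth, connected, four-dimensional (Hausdorff) manifold, and let $g$ and $\bar g$ be smooth semi-Riemannian metrics on $M$ of Lorentz signature $(1,3)$ such that $\bar g = \Omega^2 g$ for some smooth function $\Omega : M \to \mathbb{R}$. A \emph{curve} is a smooth map $\gamma : I \to M$, where $I \subseteq \mathbb{R}$ is an interval (possibly infinite, not necessarily open, with more than one point); smoothness means that $\gamma$ extends to a smooth map on an open interval containing $I$. It is \emph{timelike} if $g(\dot\gamma(s), \dot\gamma(s)) > 0$ for all $s \in I$ (equivalently, for $\bar g$ in place of $g$). It is a \emph{geodesic} with respect to a metric if its tangent field $\xi$ satisfies $\nabla_\xi \xi = 0$, where $\nabla$ is the Levi-Civita derivative operator of that metric. It \emph{can be reparametrized so as to be a geodesic} if there are an interval $I_2$ and a smooth map $\tau$ from $I_2$ onto $I$, with positive derivative everywhere, such that $\gamma \circ \tau$ is a geodesic. Suppose that $\bar g$ and $g$ agree as to which timelike curves can be reparametrized so as to be geodesics: for every timelike curve $\gamma$, $\gamma$ can be reparametrized so as to be a geodesic with respect to $\bar g$ if and only if it can be reparametrized so as to be a geodesic with respect to $g$. Then $\Omega$ is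 constant. -/

import Mathlib

open scoped ContDiff Manifold

namespace Spacetime

noncomputable section

/-- The model space of four-dimensional manifolds. -/
abbrev E4 : Type := EuclideanSpace ℝ (Fin 4)

/-- The diagonal entries of a metric of signature `(1, 3)` in an orthonormal basis. -/
def lorentzSign (i : Fin 4) : ℝ := if i = 0 then 1 else -1

section Metric

variable (M : Type*) [TopologicalSpace M] [ChartedSpace E4 M] [IsManifold 𝓘(ℝ, E4) ∞ M]

/-- A smooth semi-Riemannian metric of Lorentz signature `(1, 3)` on the four-dimensional
smooth manifold `M`. -/
structure LorentzMetric where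
  /-- The bilinear form on each tangent space. -/
  inner (p : M) : TangentSpace 𝓘(ℝ, E4) p →L[ℝ] TangentSpace 𝓘(ℝ, E4) p →L[ℝ] ℝ
  symm (p : M) (u v : TangentSpace 𝓘(ℝ, E4) p) : inner p u v = inner p v u
  signature (p : M) : ∃ ξ : Module.Basis (Fin 4) ℝ (TangentSpace 𝓘(ℝ, E4) p),
    ∀ i j, inner p (ξ i) (ξ j) = if i = j then lorentzSign i else 0
  contMDiff : ContMDiff 𝓘(ℝ, E4) (𝓘(ℝ, E4).prod 𝓘(ℝ, E4 →L[ℝ] E4 →L[ℝ] ℝ)) ∞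
    (fun p ↦ Bundle.TotalSpace.mk' (E4 →L[ℝ] E4 →L[ℝ] ℝ) p (inner p))

end Metric

section Coordinates

/-- The covector `w ↦ ½ (∂_u G(v, w) + ∂_v G(u, w) - ∂_w G(u, v))` at the point `y`, for a field
`G` of bilinear forms on (an open subset of) coordinate space: the Christoffel symbol of the
first kind. -/
def christoffelLower (G : E4 → E4 →L[ℝ] E4 →L[ℝ] ℝ) (y u v : E4) : E4 →L[ℝ] ℝ :=
  (1 / 2 : ℝ) • (fderiv ℝ G y u v + fderiv ℝ G y v u - ((fderiv ℝ G y).flip u).flip v)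

/-- The vector `Γ(y)(u, v)` with components `Γᵏᵢⱼ(y) uⁱ vʲ`, obtained by raising the index of
`christoffelLower` with the (nondegenerate) form `G y`. It gives the connection coefficients of the
unique torsion-free derivative operator compatible with `G`; see `christoffel_isLeviCivita` and
`christoffel_unique`. -/
def christoffel (G : E4 → E4 →L[ℝ] E4 →L[ℝ] ℝ) (y u v : E4) : E4 :=
  (G y).inverse (christoffelLower G y u v)

theorem apply_christoffel {G : E4 → E4 →L[ℝ] E4 →L[ℝ] ℝ} {y : E4}
    (hG : (G y).IsInvertible) (u v w : E4) :
    G y (christoffel G y u v) w =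
      1 / 2 * (fderiv ℝ G y u v w + fderiv ℝ G y v u w - fderiv ℝ G y w u v) := by
  have h : G y (christoffel G y u v) = christoffelLower G y u v := by
    obtain ⟨L, hL⟩ := hG
    rw [christoffel, ← hL]
    simp
  rw [h]
  simp [christoffelLower]

theorem fderiv_symm {G : E4 → E4 →L[ℝ] E4 →L[ℝ] ℝ} {y : E4}
    (hd : DifferentiableAt ℝ G y) (hs : ∀ᶠ z in nhds y, ∀ u v, G z u v = G z v u) (a u v : E4) :
    fderiv ℝ G y a u v = fderiv ℝ G y a v u := by
  have h (p q : E4) := (hd.hasFDerivAt.clm_apply (hasFDerivAt_const p y)).clm_apply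
    (hasFDerivAt_const q y)
  have he : (fun z ↦ G z v u) =ᶠ[nhds y] fun z ↦ G z u v := by
    filter_upwards [hs] with z hz using hz v u
  have h3 := congrArg (fun T ↦ T a) ((h u v).unique ((h v u).congr_of_eventuallyEq he.symm))
  simpa using h3

/-- `christoffel` is symmetric (no torsion) and compatible with the metric. -/
theorem christoffel_isLeviCivita {G : E4 → E4 →L[ℝ] E4 →L[ℝ] ℝ} {y : E4}
    (hG : (G y).IsInvertible) (hd : DifferentiableAt ℝ G y)
    (hs : ∀ᶠ z in nhds y, ∀ u v, G z u v = G z v u) :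
    (∀ u v, christoffel G y u v = christoffel G y v u) ∧
    ∀ a u v, fderiv ℝ G y a u v
      = G y (christoffel G y a u) v + G y u (christoffel G y a v) := by
  have hf := fderiv_symm hd hs
  refine ⟨fun u v ↦ ?_, fun a u v ↦ ?_⟩
  · have : christoffelLower G y u v = christoffelLower G y v u := by
      ext w
      simp [christoffelLower, hf w u v]
      ring
    rw [christoffel, christoffel, this]
  · rw [hs.self_of_nhds u (christoffel G y a v), apply_christoffel hG, apply_christoffel hG,
      hf u a v, hf a v u, hf v a u]
    ring

/-- `christoffel` is the only symmetric and metric-compatible choice of coefficients. -/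
theorem christoffel_unique {G : E4 → E4 →L[ℝ] E4 →L[ℝ] ℝ} {y : E4}
    (hG : (G y).IsInvertible) (hs : ∀ u v, G y u v = G y v u) (Γ : E4 → E4 → E4)
    (hsymm : ∀ u v, Γ u v = Γ v u)
    (hcomp : ∀ a u v, fderiv ℝ G y a u v = G y (Γ a u) v + G y u (Γ a v)) (u v : E4) :
    Γ u v = christoffel G y u v := by
  have h : G y (Γ u v) = G y (christoffel G y u v) := by
    ext w
    rw [apply_christoffel hG, hcomp u v w, hcomp v u w, hcomp w u v, hsymm v u, hsymm w u,
      hsymm w v, hs v (Γ u w), hs u (Γ v w)]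
    ring
  obtain ⟨L, hL⟩ := hG
  rw [← hL] at h
  exact L.injective h

end Coordinates

section Curves

/-- A function `f` on an interval `I` of real numbers is smooth if it is the restriction to `I` of
a smooth map on an open interval containing `I`. -/
def SmoothOnInterval {F : Type*} [NormedAddCommGroup F] [NormedSpace ℝ F] {N : Type*}
    [TopologicalSpace N] [ChartedSpace F N] (f : ℝ → N) (I : Set ℝ) : Prop :=
  ∃ (J : Set ℝ) (h : ℝ → N), IsOpen J ∧ J.OrdConnected ∧ I ⊆ J ∧
    ContMDiffOn 𝓘(ℝ, ℝ) 𝓘(ℝ, F) ∞ h J ∧ Set.EqOn h f I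

variable {M : Type*} [TopologicalSpace M] [ChartedSpace E4 M]

/-- `γ`, restricted to `I`, is a curve: `I` is an interval (bounded or not, open or not, with more
than one point) and `γ` is smooth on `I`. The values of `γ` outside `I` are irrelevant. -/
structure IsCurve (γ : ℝ → M) (I : Set ℝ) : Prop where
  ordConnected : I.OrdConnected
  nontrivial : I.Nontrivial
  smooth : SmoothOnInterval (F := E4) γ I

/-- The tangent vector at `s` of the curve `γ` on `I`. -/
def velocity (γ : ℝ → M) (I : Set ℝ) (s : ℝ) : TangentSpace 𝓘(ℝ, E4) (γ s) :=
  mfderivWithin 𝓘(ℝ, ℝ) 𝓘(ℝ, E4) γ I s (1 : ℝ)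

/-- The curve `γ₂` on `I₂` is an (orientation preserving) reparametrization of `γ₁` on `I₁`. -/
def IsReparametrization (γ₂ : ℝ → M) (I₂ : Set ℝ) (γ₁ : ℝ → M) (I₁ : Set ℝ) : Prop :=
  ∃ τ : ℝ → ℝ, SmoothOnInterval (F := ℝ) τ I₂ ∧ τ '' I₂ = I₁ ∧
    (∀ s ∈ I₂, 0 < derivWithin τ I₂ s) ∧ ∀ s ∈ I₂, γ₂ s = γ₁ (τ s)

end Curves

section Geodesics

variable {M : Type*} [TopologicalSpace M] [ChartedSpace E4 M] [IsManifold 𝓘(ℝ, E4) ∞ M]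

namespace LorentzMetric

/-- The coordinate expression of `g` in the chart `e`: at `y ∈ e.target`, the form on coordinate
space that `g` at the point `e.symm y` induces through the differential of `e.symm`. -/
def inChart (g : LorentzMetric M) (e : OpenPartialHomeomorph M E4) (y : E4) :
    E4 →L[ℝ] E4 →L[ℝ] ℝ :=
  let L : E4 →L[ℝ] E4 := mfderiv 𝓘(ℝ, E4) 𝓘(ℝ, E4) e.symm y
  let B : E4 →L[ℝ] E4 →L[ℝ] ℝ := g.inner (e.symm y)
  B.bilinearComp L L

theorem nondegenerate (g : LorentzMetric M) (p : M) (u : TangentSpace 𝓘(ℝ, E4) p)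
    (h : ∀ v, g.inner p u v = 0) : u = 0 := by
  obtain ⟨ξ, hξ⟩ := g.signature p
  rw [← ξ.sum_repr u]
  apply Finset.sum_eq_zero
  intro i _
  have := h (ξ i)
  rw [← ξ.sum_repr u] at this
  simp only [map_sum, map_smul, sum_apply, smul_apply, hξ] at this
  simp [lorentzSign] at this
  have h2 : ξ.repr u i = 0 := by
    by_cases h0 : i = 0 <;> simp_all
  simp [h2]

/-- The coordinate expression of a metric is invertible, as `christoffel` requires. -/
theorem inChart_isInvertible (g : LorentzMetric M) (e : OpenPartialHomeomorph M E4)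
    (he : e ∈ IsManifold.maximalAtlas 𝓘(ℝ, E4) ∞ M) (y : E4) (hy : y ∈ e.target) : (g.inChart e y).IsInvertible := by
  have he1 : e ∈ IsManifold.maximalAtlas 𝓘(ℝ, E4) 1 M :=
    IsManifold.maximalAtlas_subset_of_le (by simp) he
  have hd1 := mdifferentiableAt_symm_of_mem_maximalAtlas he1 hy
  have hd2 := mdifferentiableAt_of_mem_maximalAtlas he1 (e.map_target hy)
  have hc : (mfderiv 𝓘(ℝ, E4) 𝓘(ℝ, E4) e (e.symm y)).comp
      (mfderiv 𝓘(ℝ, E4) 𝓘(ℝ, E4) e.symm y) = ContinuousLinearMap.id ℝ E4 := by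
    rw [← mfderiv_comp y hd2 hd1]
    rw [Filter.EventuallyEq.mfderiv_eq (f := id), mfderiv_id]
    · rfl
    filter_upwards [e.open_target.mem_nhds hy] with z hz using e.right_inv hz
  let L : E4 →L[ℝ] E4 := mfderiv 𝓘(ℝ, E4) 𝓘(ℝ, E4) e.symm y
  have hinj : Function.Injective L := by
    intro a b hab
    have h := congrArg (fun z => (mfderiv 𝓘(ℝ, E4) 𝓘(ℝ, E4) e (e.symm y)) z) hab
    have ha := DFunLike.congr_fun hc a
    have hb := DFunLike.congr_fun hc b
    exact ha.symm.trans (h.trans hb)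
  have hsurj := LinearMap.injective_iff_surjective (f := L.toLinearMap) |>.1 hinj
  have hG : Function.Injective (g.inChart e y) := by
    rw [injective_iff_map_eq_zero]
    intro u hu
    apply hinj
    rw [map_zero]
    apply g.nondegenerate (e.symm y)
    intro v
    obtain ⟨w, rfl⟩ := hsurj v
    exact DFunLike.congr_fun hu w
  have hfr : Module.finrank ℝ E4 = Module.finrank ℝ (E4 →L[ℝ] ℝ) := by
    rw [← LinearMap.toContinuousLinearMap.finrank_eq]
    exact (Subspace.dual_finrank_eq).symm
  refine ⟨(LinearEquiv.ofInjectiveOfFinrankEq (g.inChart e y).toLinearMap hG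
    hfr).toContinuousLinearEquiv, ?_⟩
  ext; rfl

/-- The curve `γ` on `I` is timelike with respect to `g`. -/
def IsTimelike (g : LorentzMetric M) (γ : ℝ → M) (I : Set ℝ) : Prop :=
  ∀ s ∈ I, 0 < g.inner (γ s) (velocity γ I s) (velocity γ I s)

/-- The curve `γ` on `I` is a geodesic of `g`: its tangent field `ξ` satisfies `∇_ξ ξ = 0`, where
`∇` is the Levi-Civita derivative operator of `g`. In any smooth chart, with `c` the coordinate
expression of `γ`, this is the equation `c'' + Γ(c)(c', c') = 0`. -/
def IsGeodesic (g : LorentzMetric M) (γ : ℝ → M) (I : Set ℝ) : Prop :=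
  ∀ s ∈ I, ∀ e ∈ IsManifold.maximalAtlas 𝓘(ℝ, E4) ∞ M, γ s ∈ e.source →
    let c : ℝ → E4 := fun t ↦ e (γ t)
    let c' : ℝ → E4 := derivWithin c I
    derivWithin c' I s + christoffel (g.inChart e) (c s) (c' s) (c' s) = 0

/-- The curve `γ` on `I` can be reparametrized so as to be a geodesic of `g`. -/
def IsGeodesicUpToReparam (g : LorentzMetric M) (γ : ℝ → M) (I : Set ℝ) : Prop :=
  ∃ (γ₂ : ℝ → M) (I₂ : Set ℝ), IsCurve γ₂ I₂ ∧ IsReparametrization γ₂ I₂ γ I ∧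
    g.IsGeodesic γ₂ I₂

end LorentzMetric

end Geodesics

end

end Spacetime

namespace Spacetime

set_option maxSynthPendingDepth 3

noncomputable section

open Set Filter Topology

/-! ### Connections, geodesics and conformal change on a normed space -/

section Coordinates

variable {E : Type*} [NormedAddCommGroup E] [NormedSpace ℝ E]

/-! Put F = Ω², and let v be a timelike vector at a point. The g-geodesic with initial velocity v
stays timelike for a short time (`exists_geodesic_coordinates`), so by hypothesis it is a ḡ-geodesic
after reparametrization. Reparametrizing changes the acceleration only along the velocity
(`IsGeodesicUpToReparam.exists_acceleration_eq_smul`), hence Γ̄(v,v) − Γ(v,v) = κv for some κ. The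
conformal change formula, on the other hand, gives F(Γ̄(v,v) − Γ(v,v)) = dF(v)v − ½g(v,v) grad F. So
grad F is a multiple of v (`fderiv_conformal_factor`).

This holds for every timelike v, and two linearly independent ones force dF = 0
(`fderiv_conformal_factor_eq_zero`). Since ḡ is nondegenerate, Ω has no zeros, so dΩ = 0 and
connectedness finishes the proof.

The construction takes place in one chart, whereas `IsGeodesic` quantifies over all charts;
`leviCivita_pullback` and `geodesic_equation_pullback` bridge the two. -/

/-- The Levi-Civita connection coefficients of a field `G` of bilinear forms on a normed space. -/
def leviCivita (G : E → E →L[ℝ] E →L[ℝ] ℝ) (y u v : E) : E :=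
  (G y).inverse
    ((1 / 2 : ℝ) • (fderiv ℝ G y u v + fderiv ℝ G y v u - ((fderiv ℝ G y).flip u).flip v))

theorem apply_leviCivita {G : E → E →L[ℝ] E →L[ℝ] ℝ} {y : E}
    (hG : (G y).IsInvertible) (u v w : E) :
    G y (leviCivita G y u v) w =
      1 / 2 * (fderiv ℝ G y u v w + fderiv ℝ G y v u w - fderiv ℝ G y w u v) := by
  have h : G y (leviCivita G y u v) = (1 / 2 : ℝ) •
      (fderiv ℝ G y u v + fderiv ℝ G y v u - ((fderiv ℝ G y).flip u).flip v) := by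
    obtain ⟨L, hL⟩ := hG
    rw [leviCivita, ← hL]
    simp
  rw [h]
  simp

/-- The lowered symbol is quadratic in the velocity, and `G y` is injective. This produces the
squared speed factor under reparametrization. -/
theorem leviCivita_smul_smul {G : E → E →L[ℝ] E →L[ℝ] ℝ} {y : E} (hG : (G y).IsInvertible)
    (a : ℝ) (u : E) : leviCivita G y (a • u) (a • u) = a ^ 2 • leviCivita G y u u := by
  have h : G y (leviCivita G y (a • u) (a • u)) = G y (a ^ 2 • leviCivita G y u u) := by
    ext w
    rw [apply_leviCivita hG, map_smul (G y), smul_apply, apply_leviCivita hG]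
    simp
    ring
  obtain ⟨L, hL⟩ := hG
  rw [← hL] at h
  exact L.injective h

/-- Operator inversion is smooth at invertible operators; all other ingredients are smooth in G, its
derivative and the vector. This makes the geodesic equation a smooth ODE. -/
theorem contDiffOn_leviCivita [CompleteSpace E] {G : E → E →L[ℝ] E →L[ℝ] ℝ} {U : Set E} (hU : IsOpen U)
    (hG : ContDiffOn ℝ ∞ G U) (hinv : ∀ y ∈ U, (G y).IsInvertible) :
    ContDiffOn ℝ ∞ (fun z : E × E ↦ leviCivita G z.1 z.2 z.2) (U ×ˢ univ) := by
  have h1 : ContDiffOn ℝ ∞ (fun z : E × E ↦ z.1) (U ×ˢ univ) := contDiff_fst.contDiffOn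
  have h2 : ContDiffOn ℝ ∞ (fun z : E × E ↦ z.2) (U ×ˢ univ) := contDiff_snd.contDiffOn
  have hm : MapsTo (fun z : E × E ↦ z.1) (U ×ˢ univ) U := fun z hz ↦ hz.1
  have hd : ContDiffOn ℝ ∞ (fun z : E × E ↦ fderiv ℝ G z.1) (U ×ˢ univ) :=
    (hG.fderiv_of_isOpen hU (by simp)).comp h1 hm
  have hi : ContDiffOn ℝ ∞ (fun z : E × E ↦ (G z.1).inverse) (U ×ˢ univ) := by
    intro z hz
    exact (hinv z.1 hz.1).contDiffAt_map_inverse.comp_contDiffWithinAt z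
      ((hG.comp h1 hm) z hz)
  refine hi.clm_apply ?_
  have hflip : ContDiffOn ℝ ∞ (fun z : E × E ↦ ((fderiv ℝ G z.1).flip z.2).flip z.2)
      (U ×ˢ univ) := by
    have hf : ContDiffOn ℝ ∞ (fun z : E × E ↦ (fderiv ℝ G z.1).flip z.2) (U ×ˢ univ) :=
      ((ContinuousLinearMap.flipₗᵢ ℝ E E (E →L[ℝ] ℝ)).contDiff.comp_contDiffOn hd).clm_apply h2
    exact ((ContinuousLinearMap.flipₗᵢ ℝ E E ℝ).contDiff.comp_contDiffOn hf).clm_apply h2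
  have ha := (hd.clm_apply h2).clm_apply h2
  exact ((ha.add ha).sub hflip).const_smul (1 / 2 : ℝ)

/-- The transformation law of the Christoffel symbols. -/
theorem leviCivita_pullback [FiniteDimensional ℝ E] {G G' : E → E →L[ℝ] E →L[ℝ] ℝ} {φ : E → E} {y : E}
    (hG : (G y).IsInvertible) (hG' : (G' (φ y)).IsInvertible)
    (hd' : DifferentiableAt ℝ G' (φ y)) (hs' : ∀ᶠ z in 𝓝 (φ y), ∀ u v, G' z u v = G' z v u)
    (hφ : ContDiffAt ℝ 2 φ y)
    (hpull : ∀ᶠ z in 𝓝 y, ∀ u v, G z u v = G' (φ z) (fderiv ℝ φ z u) (fderiv ℝ φ z v))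
    (hd : DifferentiableAt ℝ G y) (u v : E) :
    fderiv ℝ φ y (leviCivita G y u v) =
      leviCivita G' (φ y) (fderiv ℝ φ y u) (fderiv ℝ φ y v) + fderiv ℝ (fderiv ℝ φ) y u v := by
  have hφ1 : HasFDerivAt φ (fderiv ℝ φ y) y := (hφ.differentiableAt (by simp)).hasFDerivAt
  have hφ2 : HasFDerivAt (fderiv ℝ φ) (fderiv ℝ (fderiv ℝ φ) y) y :=
    ((hφ.fderiv_right (m := 1) (by norm_num)).differentiableAt (by simp)).hasFDerivAt
  have hsymm : ∀ u v, fderiv ℝ (fderiv ℝ φ) y u v = fderiv ℝ (fderiv ℝ φ) y v u :=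
    fun u v ↦ (hφ.isSymmSndFDerivAt (by simp)).eq u v
  set A := fderiv ℝ φ y
  set D := fderiv ℝ (fderiv ℝ φ) y
  -- Differentiate the pullback identity. In the Christoffel combination, symmetry of the second
  -- derivative D cancels all D-terms except the one containing D u v.
  have key (a p q : E) : fderiv ℝ G y a p q = fderiv ℝ G' (φ y) (A a) (A p) (A q) +
      G' (φ y) (D a p) (A q) + G' (φ y) (A p) (D a q) := by
    have e1 := (hd.hasFDerivAt.clm_apply (hasFDerivAt_const p y)).clm_apply
      (hasFDerivAt_const q y)
    have e2 := ((hd'.hasFDerivAt.comp y hφ1).clm_apply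
      (hφ2.clm_apply (hasFDerivAt_const p y))).clm_apply (hφ2.clm_apply (hasFDerivAt_const q y))
    have e3 := e1.unique (e2.congr_of_eventuallyEq (by
      filter_upwards [hpull] with z hz using by simpa using hz p q))
    have e4 := DFunLike.congr_fun e3 a
    simp at e4
    rw [e4]
    ring
  -- A vector killed by A would lie in the kernel of the invertible form `G y`.
  have hAinj : Function.Injective A := by
    rw [injective_iff_map_eq_zero]
    intro a ha
    obtain ⟨L, hL⟩ := hG
    apply L.injective
    ext w
    have := hpull.self_of_nhds a w
    rw [← hL] at this
    change (L a) w = G' (φ y) (A a) _ at this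
    rw [this, ha]
    simp
  have hAsurj := LinearMap.injective_iff_surjective (f := A.toLinearMap) |>.1 hAinj
  have hfin : G' (φ y) (A (leviCivita G y u v)) =
      G' (φ y) (leviCivita G' (φ y) (A u) (A v) + D u v) := by
    ext w'
    obtain ⟨w, rfl⟩ := hAsurj w'
    have h1 := apply_leviCivita hG u v w
    have h2 := apply_leviCivita hG' (A u) (A v) (A w)
    rw [hpull.self_of_nhds] at h1
    change G' (φ y) (A _) (A w) = _ at h1
    change G' (φ y) (A _) (A w) = G' (φ y) _ (A w)
    rw [h1, map_add, add_apply, h2, key, key, key, hsymm v u, hsymm w u, hsymm w v]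
    have hs := hs'.self_of_nhds
    rw [hs (A v) (D u w), hs (A u) (D v w)]
    ring
  obtain ⟨L, hL⟩ := hG'
  rw [← hL] at hfin
  exact L.injective hfin

/-- The geodesic equation is invariant under a change of coordinates. -/
theorem geodesic_equation_pullback {G G' : E → E →L[ℝ] E →L[ℝ] ℝ} {φ c w : ℝ → E}
    {a : E} {t : ℝ} {ψ : E → E} (hψ : ContDiffAt ℝ 2 ψ (c t))
    (hc : ∀ᶠ s in 𝓝 t, HasDerivAt c (w s) s) (hw : HasDerivAt w a t)
    (hφ : φ =ᶠ[𝓝 t] ψ ∘ c)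
    (hΓ : fderiv ℝ ψ (c t) (leviCivita G (c t) (w t) (w t)) =
      leviCivita G' (ψ (c t)) (fderiv ℝ ψ (c t) (w t)) (fderiv ℝ ψ (c t) (w t)) +
        fderiv ℝ (fderiv ℝ ψ) (c t) (w t) (w t))
    (ha : a + leviCivita G (c t) (w t) (w t) = 0) :
    deriv (deriv φ) t + leviCivita G' (φ t) (deriv φ t) (deriv φ t) = 0 := by
  have hct : ContinuousAt c t := hc.self_of_nhds.continuousAt
  have hev : ∀ᶠ s in 𝓝 t, ContDiffAt ℝ 2 ψ (c s) :=
    hct.eventually (hψ.eventually (by simp))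
  have h1 : ∀ᶠ s in 𝓝 t, deriv φ s = fderiv ℝ ψ (c s) (w s) := by
    filter_upwards [hφ.eventuallyEq_nhds, hc, hev] with s h1 h2 h3
    rw [h1.deriv_eq]
    exact ((h3.differentiableAt (by simp)).hasFDerivAt.comp_hasDerivAt s h2).deriv
  have hψ2 : HasFDerivAt (fderiv ℝ ψ) (fderiv ℝ (fderiv ℝ ψ) (c t)) (c t) :=
    ((hψ.fderiv_right (m := 1) (by norm_num)).differentiableAt (by simp)).hasFDerivAt
  have h2 : deriv (deriv φ) t =
      fderiv ℝ (fderiv ℝ ψ) (c t) (w t) (w t) + fderiv ℝ ψ (c t) a := by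
    have h1' : deriv φ =ᶠ[𝓝 t] fun s ↦ fderiv ℝ ψ (c s) (w s) := h1
    rw [h1'.deriv_eq]
    exact ((hψ2.comp_hasDerivAt t hc.self_of_nhds).clm_apply hw).deriv
  have hφt : φ t = ψ (c t) := hφ.self_of_nhds
  rw [h2, h1.self_of_nhds, hφt, eq_neg_of_add_eq_zero_left ha, map_neg, hΓ]
  abel

/-- Local existence of smooth geodesics with prescribed initial data that stay in a given open set
of the tangent bundle. -/
theorem exists_geodesic_coordinates [CompleteSpace E] {G : E → E →L[ℝ] E →L[ℝ] ℝ} {U : Set E} (hU : IsOpen U)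
    (hG : ContDiffOn ℝ ∞ G U) (hinv : ∀ y ∈ U, (G y).IsInvertible) {x v : E} (hx : x ∈ U)
    (hv : 0 < G x v v) :
    ∃ ε > 0, ∃ c w : ℝ → E, c 0 = x ∧ w 0 = v ∧ ContDiffOn ℝ ∞ c (Ioo (-ε) ε) ∧
      ∀ t ∈ Ioo (-ε) ε, HasDerivAt c (w t) t ∧
        HasDerivAt w (-leviCivita G (c t) (w t) (w t)) t ∧ c t ∈ U ∧ 0 < G (c t) (w t) (w t) := by
  -- The geodesic equation as a first-order system for position and velocity.
  let f : E × E → E × E := fun z ↦ (z.2, -leviCivita G z.1 z.2 z.2)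
  have hf : ContDiffOn ℝ ∞ f (U ×ˢ univ) :=
    contDiff_snd.contDiffOn.prodMk (contDiffOn_leviCivita hU hG hinv).neg
  have hUo : IsOpen (U ×ˢ (univ : Set E)) := hU.prod isOpen_univ
  have hfx : ContDiffAt ℝ 1 f (x, v) :=
    ((hf.contDiffAt (hUo.mem_nhds (mk_mem_prod hx (mem_univ v))))).of_le (by simp)
  obtain ⟨α, hα0, ε, hε, hα⟩ :=
    hfx.exists_forall_mem_closedBall_exists_eq_forall_mem_Ioo_hasDerivAt₀ 0
  have hcont : ContinuousAt α 0 := (hα 0 (by simp [hε])).continuousAt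
  have hpos : ∀ᶠ z : E × E in 𝓝 (x, v), z ∈ U ×ˢ (univ : Set E) ∧ 0 < G z.1 z.2 z.2 := by
    refine Filter.Eventually.and (hUo.mem_nhds (mk_mem_prod hx (mem_univ v))) ?_
    have hGc : ContinuousAt (fun z : E × E ↦ G z.1) (x, v) :=
      (hG.continuousOn.continuousAt (hU.mem_nhds hx)).comp (x := (x, v)) continuousAt_fst
    exact ((hGc.clm_apply continuousAt_snd).clm_apply continuousAt_snd).eventually
      (lt_mem_nhds hv)
  rw [← hα0] at hpos
  obtain ⟨δ, hδ, hδ'⟩ := Metric.eventually_nhds_iff.1 (hcont.eventually hpos)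
  -- Halving leaves room for a closed interval, on which the regularity theorem below is applied.
  refine ⟨min ε δ / 2, by positivity, fun t ↦ (α t).1, fun t ↦ (α t).2, by simp [hα0],
    by simp [hα0], ?_, ?_⟩
  · have hsub : ∀ t ∈ Icc (-(min ε δ / 2)) (min ε δ / 2), t ∈ Ioo (0 - ε) (0 + ε) ∧ dist t 0 < δ := by
      intro t ht
      have h1 : 0 < min ε δ := lt_min hε hδ
      have h2 := min_le_left ε δ
      have h3 := min_le_right ε δ
      refine ⟨⟨by linarith [ht.1], by linarith [ht.2]⟩, ?_⟩
      rw [Real.dist_0_eq_abs, abs_lt]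
      exact ⟨by linarith [ht.1], by linarith [ht.2]⟩
    -- The existence theorem gives only a differentiable solution; smoothness of f along it
    -- bootstraps to a smooth one.
    have hsm : ContDiffOn ℝ ((⊤ : ℕ∞) : WithTop ℕ∞) α (Icc (-(min ε δ / 2)) (min ε δ / 2)) := by
      refine ODE.contDiffOn_enat_Icc_of_hasDerivWithinAt (f := fun _ ↦ f) (u := U ×ˢ univ) ?_
        (fun t ht ↦ (hα t (hsub t ht).1).hasDerivWithinAt) (fun t ht ↦ (hδ' (hsub t ht).2).1)
      exact hf.comp contDiff_snd.contDiffOn fun z hz ↦ hz.2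
    exact (contDiff_fst.comp_contDiffOn hsm).mono Ioo_subset_Icc_self
  · intro t ht
    have h1 : 0 < min ε δ := lt_min hε hδ
    have h2 := min_le_left ε δ
    have h3 := min_le_right ε δ
    have hd := hα t ⟨by linarith [ht.1], by linarith [ht.2]⟩
    have hz : dist t 0 < δ := by
      rw [Real.dist_0_eq_abs, abs_lt]
      exact ⟨by linarith [ht.1], by linarith [ht.2]⟩
    exact ⟨hd.fst, hd.snd,
      (hδ' hz).1.1, (hδ' hz).2⟩

/-- If a conformal rescaling of `G` by `F` changes the acceleration of a curve with velocity `v` by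
a multiple of `v`, then `dF` is proportional to `G v` when `v` is not null. -/
theorem fderiv_conformal_factor {G G' : E → E →L[ℝ] E →L[ℝ] ℝ} {F : E → ℝ} {y : E}
    (hG : (G y).IsInvertible) (hG' : (G' y).IsInvertible) (hd : DifferentiableAt ℝ G y)
    (hF : DifferentiableAt ℝ F y) (hconf : ∀ᶠ z in 𝓝 y, G' z = F z • G z) {v : E} {κ : ℝ}
    (hκ : leviCivita G' y v v = leviCivita G y v v + κ • v) :
    ∃ μ : ℝ, ∀ u, fderiv ℝ F y u * G y v v = μ * G y v u := by
  -- Expanding the Christoffel formula for F • G at (v, v), paired with u, gives Fκ G(v,u) = dF(v)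
  -- G(v,u) − ½ dF(u) G(v,v); solve for the last term.
  refine ⟨2 * fderiv ℝ F y v - 2 * F y * κ, fun u ↦ ?_⟩
  have hder : fderiv ℝ G' y = F y • fderiv ℝ G y + (fderiv ℝ F y).smulRight (G y) := by
    rw [EventuallyEq.fderiv_eq (show G' =ᶠ[𝓝 y] fun z ↦ F z • G z from hconf)]
    exact fderiv_fun_smul hF hd
  have h1 := apply_leviCivita hG v v u
  have h2 := apply_leviCivita hG' v v u
  rw [hκ, hder, hconf.self_of_nhds] at h2
  simp at h2
  rw [h1] at h2
  linear_combination 2 * h2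

end Coordinates

/-! ### Curves and charts on the manifold -/

theorem IsCurve.uniqueDiffOn {M : Type*} [TopologicalSpace M] [ChartedSpace E4 M] {γ : ℝ → M}
    {I : Set ℝ} (h : IsCurve γ I) : UniqueDiffOn ℝ I :=
  uniqueDiffOn_convex h.ordConnected.convex
    (h.ordConnected.convex.nontrivial_iff_nonempty_interior.1 h.nontrivial)

section Charts

variable {M : Type*} [TopologicalSpace M] [ChartedSpace E4 M]

theorem contMDiffAt_symm_of_mem_maximalAtlas_top {e : OpenPartialHomeomorph M E4}
    (he : e ∈ IsManifold.maximalAtlas 𝓘(ℝ, E4) ∞ M) {y : E4} (hy : y ∈ e.target) :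
    ContMDiffAt 𝓘(ℝ, E4) 𝓘(ℝ, E4) ∞ e.symm y :=
  (contMDiffOn_symm_of_mem_maximalAtlas he).contMDiffAt (e.open_target.mem_nhds hy)

theorem contDiffAt_transition [IsManifold 𝓘(ℝ, E4) ∞ M] {e e' : OpenPartialHomeomorph M E4}
    (he : e ∈ IsManifold.maximalAtlas 𝓘(ℝ, E4) ∞ M)
    (he' : e' ∈ IsManifold.maximalAtlas 𝓘(ℝ, E4) ∞ M) {y : E4} (hy : y ∈ e.target)
    (hy' : e.symm y ∈ e'.source) : ContDiffAt ℝ ∞ (e' ∘ e.symm) y := by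
  rw [← contMDiffAt_iff_contDiffAt]
  exact (contMDiffAt_of_mem_maximalAtlas he' hy').comp y
    (contMDiffAt_symm_of_mem_maximalAtlas_top he hy)

theorem mfderiv_symm_mfderiv {e : OpenPartialHomeomorph M E4}
    (he : e ∈ IsManifold.maximalAtlas 𝓘(ℝ, E4) ∞ M) {p : M} (hp : p ∈ e.source)
    (v : TangentSpace 𝓘(ℝ, E4) p) :
    (show E4 from mfderiv 𝓘(ℝ, E4) 𝓘(ℝ, E4) e.symm (e p) (mfderiv 𝓘(ℝ, E4) 𝓘(ℝ, E4) e p v)) =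
      (show E4 from v) := by
  have he1 : e ∈ IsManifold.maximalAtlas 𝓘(ℝ, E4) 1 M :=
    IsManifold.maximalAtlas_subset_of_le (by simp) he
  have hd1 := mdifferentiableAt_symm_of_mem_maximalAtlas he1 (e.map_source hp)
  have hd2 := mdifferentiableAt_of_mem_maximalAtlas he1 hp
  have hc : (mfderiv 𝓘(ℝ, E4) 𝓘(ℝ, E4) e.symm (e p)).comp (mfderiv 𝓘(ℝ, E4) 𝓘(ℝ, E4) e p) =
      ContinuousLinearMap.id ℝ E4 := by
    rw [← mfderiv_comp p hd1 hd2]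
    rw [Filter.EventuallyEq.mfderiv_eq (f := id), mfderiv_id]
    · rfl
    filter_upwards [e.open_source.mem_nhds hp] with z hz using e.left_inv hz
  exact DFunLike.congr_fun hc v

theorem isCurve_of_chart {e : OpenPartialHomeomorph M E4}
    (he : e ∈ IsManifold.maximalAtlas 𝓘(ℝ, E4) ∞ M) {ε : ℝ} (hε : 0 < ε) {c : ℝ → E4}
    (hc : ContDiffOn ℝ ∞ c (Ioo (-ε) ε)) (hct : ∀ t ∈ Ioo (-ε) ε, c t ∈ e.target) :
    IsCurve (e.symm ∘ c) (Ioo (-ε) ε) where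
  ordConnected := ordConnected_Ioo
  nontrivial := ⟨0, by simp [hε], ε / 2, ⟨by linarith, by linarith⟩, by positivity⟩
  smooth := ⟨Ioo (-ε) ε, e.symm ∘ c, isOpen_Ioo, ordConnected_Ioo, Subset.rfl,
    (contMDiffOn_symm_of_mem_maximalAtlas he).comp hc.contMDiffOn hct, fun _ _ ↦ rfl⟩

end Charts

/-! ### Metrics, geodesics and reparametrizations in charts -/

namespace LorentzMetric

variable {M : Type*} [TopologicalSpace M] [ChartedSpace E4 M] [IsManifold 𝓘(ℝ, E4) ∞ M]

theorem inChart_apply (g : LorentzMetric M) (e : OpenPartialHomeomorph M E4) (y u v : E4) :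
    g.inChart e y u v = g.inner (e.symm y) (mfderiv 𝓘(ℝ, E4) 𝓘(ℝ, E4) e.symm y u)
      (mfderiv 𝓘(ℝ, E4) 𝓘(ℝ, E4) e.symm y v) := rfl

theorem inChart_symm (g : LorentzMetric M) (e : OpenPartialHomeomorph M E4) (y u v : E4) :
    g.inChart e y u v = g.inChart e y v u :=
  g.symm _ _ _

theorem contDiffOn_inChart (g : LorentzMetric M) {e : OpenPartialHomeomorph M E4}
    (he : e ∈ IsManifold.maximalAtlas 𝓘(ℝ, E4) ∞ M) : ContDiffOn ℝ ∞ (g.inChart e) e.target := by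
  rw [contDiffOn_clm_apply]
  intro u
  rw [contDiffOn_clm_apply]
  intro v y hy
  -- The image of a constant coordinate field under the differential of `e.symm` is a smooth section
  -- along `e.symm`; the bundle metric is then evaluated on two of these.
  have hvec (u : E4) : ContMDiffAt 𝓘(ℝ, E4) 𝓘(ℝ, E4).tangent ∞
      (fun z ↦ Bundle.TotalSpace.mk' E4 (E := TangentSpace 𝓘(ℝ, E4)) (e.symm z)
        (mfderiv 𝓘(ℝ, E4) 𝓘(ℝ, E4) e.symm z u)) y := by
    have h1 := ((contMDiffOn_symm_of_mem_maximalAtlas he).contMDiffOn_tangentMapWithin (m := ∞)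
      (by simp) e.open_target.uniqueMDiffOn).contMDiffAt
      (x := Bundle.TotalSpace.mk' E4 (E := TangentSpace 𝓘(ℝ, E4)) y u)
      ((e.open_target.preimage (FiberBundle.continuous_proj E4 _)).mem_nhds hy)
    have h2 : ContMDiffAt 𝓘(ℝ, E4) 𝓘(ℝ, E4).tangent ∞
        (fun z : E4 ↦ Bundle.TotalSpace.mk' E4 (E := TangentSpace 𝓘(ℝ, E4)) z u) y :=
      contMDiffAt_vectorSpace_iff_contDiffAt.2 contDiffAt_const
    refine (h1.comp y h2).congr_of_eventuallyEq ?_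
    filter_upwards [e.open_target.mem_nhds hy] with z hz
    simp only [Function.comp, tangentMapWithin, mfderivWithin_of_mem_nhds (e.open_target.mem_nhds hz)]
  have h := ContMDiffAt.clm_bundle_apply₂ (F₁ := E4) (F₂ := E4) (F₃ := ℝ)
    (E₃ := Bundle.Trivial M ℝ)
    (g.contMDiff.contMDiffAt.comp y (contMDiffAt_symm_of_mem_maximalAtlas_top he hy))
    (hvec u) (hvec v)
  rw [Bundle.contMDiffAt_totalSpace] at h
  exact (contMDiffAt_iff_contDiffAt.1 h.2).contDiffWithinAt

theorem inChart_transition (g : LorentzMetric M) {e e' : OpenPartialHomeomorph M E4}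
    (he : e ∈ IsManifold.maximalAtlas 𝓘(ℝ, E4) ∞ M)
    (he' : e' ∈ IsManifold.maximalAtlas 𝓘(ℝ, E4) ∞ M) {y : E4} (hy : y ∈ e.target)
    (hy' : e.symm y ∈ e'.source) (u v : E4) :
    g.inChart e y u v = g.inChart e' (e' (e.symm y)) (fderiv ℝ (e' ∘ e.symm) y u)
      (fderiv ℝ (e' ∘ e.symm) y v) := by
  have he1 : e ∈ IsManifold.maximalAtlas 𝓘(ℝ, E4) 1 M :=
    IsManifold.maximalAtlas_subset_of_le (by simp) he
  have he1' : e' ∈ IsManifold.maximalAtlas 𝓘(ℝ, E4) 1 M :=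
    IsManifold.maximalAtlas_subset_of_le (by simp) he'
  have hd1 := mdifferentiableAt_symm_of_mem_maximalAtlas he1 hy
  have hd2 := mdifferentiableAt_of_mem_maximalAtlas he1' hy'
  have hA (u : E4) : (show E4 from mfderiv 𝓘(ℝ, E4) 𝓘(ℝ, E4) e'.symm (e' (e.symm y))
      (fderiv ℝ (e' ∘ e.symm) y u)) = (show E4 from mfderiv 𝓘(ℝ, E4) 𝓘(ℝ, E4) e.symm y u) := by
    have h := mfderiv_comp y hd2 hd1
    rw [mfderiv_eq_fderiv] at h
    rw [h]
    exact mfderiv_symm_mfderiv he' hy' _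
  have hp : e'.symm (e' (e.symm y)) = e.symm y := e'.left_inv hy'
  -- The base points are only propositionally equal, so the forms are compared through this
  -- substitution on the common model space.
  have hgen (p q : M) (hpq : p = q) (a b a' b' : E4) (ha : a = a') (hb : b = b') :
      g.inner p a b = g.inner q a' b' := by
    subst hpq ha hb
    rfl
  exact (hgen _ _ hp _ _ _ _ (hA u) (hA v)).symm

/-- A curve satisfying the geodesic equation in one chart is a smooth geodesic. -/
theorem isGeodesic_of_chart (g : LorentzMetric M) {e : OpenPartialHomeomorph M E4}
    (he : e ∈ IsManifold.maximalAtlas 𝓘(ℝ, E4) ∞ M) {I : Set ℝ} (hI : IsOpen I) {c w : ℝ → E4}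
    (hc : ∀ t ∈ I, HasDerivAt c (w t) t)
    (hw : ∀ t ∈ I, HasDerivAt w (-christoffel (g.inChart e) (c t) (w t) (w t)) t)
    (hct : ∀ t ∈ I, c t ∈ e.target) : g.IsGeodesic (e.symm ∘ c) I := by
  intro s hs e' he' hse'
  have hse : e.symm (c s) ∈ e'.source := hse'
  have hφ := contDiffAt_transition he he' (hct s hs) hse
  have hΓ := leviCivita_pullback (G := g.inChart e) (G' := g.inChart e') (φ := e' ∘ e.symm)
    (g.inChart_isInvertible e he _ (hct s hs))
    (g.inChart_isInvertible e' he' _ (e'.map_source hse))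
    (((g.contDiffOn_inChart he').contDiffAt
      (e'.open_target.mem_nhds (e'.map_source hse))).differentiableAt (by simp))
    (Eventually.of_forall fun z ↦ g.inChart_symm e' z) (contDiffAt_infty.1 hφ 2)
    (by
      have h1 : ∀ᶠ z in 𝓝 (c s), e.symm z ∈ e'.source :=
        (e.continuousAt_symm (hct s hs)).eventually (e'.open_source.mem_nhds hse)
      filter_upwards [h1, e.open_target.mem_nhds (hct s hs)] with z hz hz'
      exact g.inChart_transition he he' hz' hz)
    (((g.contDiffOn_inChart he).contDiffAt
      (e.open_target.mem_nhds (hct s hs))).differentiableAt (by simp)) (w s) (w s)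
  have hnhds := hI.mem_nhds hs
  have key := geodesic_equation_pullback (φ := fun t ↦ e' (e.symm (c t))) (t := s)
    (contDiffAt_infty.1 hφ 2)
    (by filter_upwards [hnhds] with t ht using hc t ht) (hw s hs) (by rfl) hΓ
    (neg_add_cancel _)
  have hder : ∀ t ∈ I, derivWithin (fun t ↦ e' (e.symm (c t))) I t =
      deriv (fun t ↦ e' (e.symm (c t))) t := fun t ht ↦ derivWithin_of_mem_nhds (hI.mem_nhds ht)
  have hder2 : derivWithin (derivWithin (fun t ↦ e' (e.symm (c t))) I) I s =
      deriv (deriv (fun t ↦ e' (e.symm (c t)))) s := by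
    rw [derivWithin_congr hder (hder s hs), derivWithin_of_mem_nhds hnhds]
  -- On `E4`, `christoffel` unfolds to `leviCivita`.
  change derivWithin (derivWithin (fun t ↦ e' (e.symm (c t))) I) I s +
    leviCivita (g.inChart e') (e' (e.symm (c s))) (derivWithin (fun t ↦ e' (e.symm (c t))) I s)
      (derivWithin (fun t ↦ e' (e.symm (c t))) I s) = 0
  rw [hder2, hder s hs]
  exact key

theorem isTimelike_of_chart (g : LorentzMetric M) {e : OpenPartialHomeomorph M E4}
    (he : e ∈ IsManifold.maximalAtlas 𝓘(ℝ, E4) ∞ M) {I : Set ℝ} (hI : IsOpen I) {c w : ℝ → E4}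
    (hc : ∀ t ∈ I, HasDerivAt c (w t) t) (hct : ∀ t ∈ I, c t ∈ e.target)
    (hpos : ∀ t ∈ I, 0 < g.inChart e (c t) (w t) (w t)) : g.IsTimelike (e.symm ∘ c) I := by
  intro s hs
  have hd := (contMDiffAt_symm_of_mem_maximalAtlas_top he (hct s hs)).mdifferentiableAt (by simp)
  have hdc : MDifferentiableAt 𝓘(ℝ, ℝ) 𝓘(ℝ, E4) c s :=
    (hc s hs).differentiableAt.mdifferentiableAt
  have hv : (show E4 from velocity (e.symm ∘ c) I s) =
      (show E4 from mfderiv 𝓘(ℝ, E4) 𝓘(ℝ, E4) e.symm (c s) (w s)) := by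
    rw [velocity, mfderivWithin_of_mem_nhds (hI.mem_nhds hs), mfderiv_comp s hd hdc,
      mfderiv_eq_fderiv, (hc s hs).hasFDerivAt.fderiv]
    change mfderiv 𝓘(ℝ, E4) 𝓘(ℝ, E4) e.symm (c s) ((1 : ℝ) • w s) = _
    rw [one_smul]
  have h := hpos s hs
  rw [inChart_apply] at h
  change 0 < g.inner (e.symm (c s)) (show E4 from velocity (e.symm ∘ c) I s)
    (show E4 from velocity (e.symm ∘ c) I s)
  rw [hv]
  exact h

theorem IsGeodesic.isGeodesicUpToReparam {g : LorentzMetric M} {γ : ℝ → M} {I : Set ℝ}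
    (h : g.IsGeodesic γ I) (hγ : IsCurve γ I) : g.IsGeodesicUpToReparam γ I := by
  refine ⟨γ, I, hγ, ⟨id, ⟨univ, id, isOpen_univ, ordConnected_univ, subset_univ _,
    contMDiff_id.contMDiffOn, fun _ _ ↦ rfl⟩, image_id I, fun s hs ↦ ?_, fun _ _ ↦ rfl⟩, h⟩
  have hu := hγ.uniqueDiffOn s hs
  rw [derivWithin_id _ _ hu]
  exact one_pos

/-- If a curve given in a chart can be reparametrized as a geodesic, then its coordinate
acceleration is proportional to its velocity. -/
theorem IsGeodesicUpToReparam.exists_acceleration_eq_smul {g : LorentzMetric M}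
    {e : OpenPartialHomeomorph M E4} (he : e ∈ IsManifold.maximalAtlas 𝓘(ℝ, E4) ∞ M)
    {I : Set ℝ} {c w : ℝ → E4} {a : E4} {s : ℝ} (hs : s ∈ I) (hc : ∀ t ∈ I, HasDerivAt c (w t) t)
    (hw : HasDerivAt w a s) (hct : ∀ t ∈ I, c t ∈ e.target)
    (h : g.IsGeodesicUpToReparam (e.symm ∘ c) I) :
    ∃ κ : ℝ, a + christoffel (g.inChart e) (c s) (w s) (w s) = κ • w s := by
  obtain ⟨γ₂, I₂, hγ₂, ⟨τ, ⟨J, σ, hJ, -, hI₂J, hσ, hστ⟩, hτI, hτpos, hγτ⟩, hgeo⟩ := h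
  have hσJ : ContDiffOn ℝ ∞ σ J := contMDiffOn_iff_contDiffOn.1 hσ
  -- The smooth extension σ replaces τ, so that ordinary derivatives are available even at endpoints
  -- of I₂.
  have hu := hγ₂.uniqueDiffOn
  have hmem : ∀ t ∈ I₂, σ t ∈ I := fun t ht ↦ by
    rw [hστ ht, ← hτI]
    exact mem_image_of_mem τ ht
  have hσd : ∀ t ∈ I₂, HasDerivAt σ (deriv σ t) t := fun t ht ↦
    ((hσJ.contDiffAt (hJ.mem_nhds (hI₂J ht))).differentiableAt (by simp)).hasDerivAt
  have hσpos : ∀ t ∈ I₂, 0 < deriv σ t := fun t ht ↦ by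
    have := hτpos t ht
    rwa [← derivWithin_congr hστ (hστ ht), (hσd t ht).hasDerivWithinAt.derivWithin (hu t ht)]
      at this
  obtain ⟨r, hr, hrs⟩ : s ∈ τ '' I₂ := hτI ▸ hs
  rw [← hστ hr] at hrs
  have hchart : ∀ t ∈ I₂, e (γ₂ t) = c (σ t) := fun t ht ↦ by
    rw [hγτ t ht, ← hστ ht]
    exact e.right_inv (hct _ (hmem t ht))
  have hd1 : ∀ t ∈ I₂, derivWithin (fun t ↦ e (γ₂ t)) I₂ t = deriv σ t • w (σ t) := fun t ht ↦ by
    rw [derivWithin_congr hchart (hchart t ht)]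
    exact ((hc _ (hmem t ht)).scomp t (hσd t ht)).hasDerivWithinAt.derivWithin (hu t ht)
  have hσ2 : HasDerivAt (deriv σ) (deriv (deriv σ) r) r :=
    (((hσJ.deriv_of_isOpen hJ (m := 1) (by norm_cast)).contDiffAt
      (hJ.mem_nhds (hI₂J hr))).differentiableAt (by simp)).hasDerivAt
  have hd2 : derivWithin (derivWithin (fun t ↦ e (γ₂ t)) I₂) I₂ r =
      deriv σ r • deriv σ r • a + deriv (deriv σ) r • w s := by
    rw [derivWithin_congr hd1 (hd1 r hr)]
    subst hrs
    exact (hσ2.smul (hw.scomp r (hσd r hr))).hasDerivWithinAt.derivWithin (hu r hr)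
  have hsrc : γ₂ r ∈ e.source := by
    rw [hγτ r hr, ← hστ hr]
    exact e.map_target (hct _ (hmem r hr))
  have heq := hgeo r hr e he hsrc
  change derivWithin (derivWithin (fun t ↦ e (γ₂ t)) I₂) I₂ r + leviCivita (g.inChart e) (e (γ₂ r))
    (derivWithin (fun t ↦ e (γ₂ t)) I₂ r) (derivWithin (fun t ↦ e (γ₂ t)) I₂ r) = 0 at heq
  rw [hd2, hd1 r hr, hchart r hr, hrs,
    leviCivita_smul_smul (g.inChart_isInvertible e he _ (hct s hs))] at heq
  have hne : deriv σ r ≠ 0 := (hσpos r hr).ne'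
  -- The geodesic equation for the reparametrized curve now reads σ'²(a + Γ(w,w)) + σ''w = 0.
  refine ⟨-(deriv (deriv σ) r / deriv σ r ^ 2), ?_⟩
  have hne2 : deriv σ r ^ 2 ≠ 0 := pow_ne_zero 2 hne
  apply smul_right_injective E4 hne2
  change deriv σ r ^ 2 • (a + leviCivita (g.inChart e) (c s) (w s) (w s)) = _
  simp only
  rw [smul_smul, mul_neg, mul_div_cancel₀ _ hne2, neg_smul, smul_add, sq, mul_smul, ← mul_smul,
    ← sq, eq_neg_iff_add_eq_zero, ← heq]
  module

/-! ### Vanishing of the derivative of the conformal factor -/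

theorem exists_chart_frame (g : LorentzMetric M) {e : OpenPartialHomeomorph M E4}
    (he : e ∈ IsManifold.maximalAtlas 𝓘(ℝ, E4) ∞ M) {y : E4} (hy : y ∈ e.target) :
    ∃ η : Fin 4 → E4, ∀ i j, g.inChart e y (η i) (η j) = if i = j then lorentzSign i else 0 := by
  have hp := e.map_target hy
  obtain ⟨ξ, hξ⟩ := g.signature (e.symm y)
  refine ⟨fun i ↦ mfderiv 𝓘(ℝ, E4) 𝓘(ℝ, E4) e (e.symm y) (ξ i), fun i j ↦ ?_⟩
  rw [← hξ i j]
  have h (i) := mfderiv_symm_mfderiv he hp (ξ i)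
  rw [e.right_inv hy] at h
  change g.inner (e.symm y) (show E4 from mfderiv 𝓘(ℝ, E4) 𝓘(ℝ, E4) e.symm y _)
    (show E4 from mfderiv 𝓘(ℝ, E4) 𝓘(ℝ, E4) e.symm y _) = _
  erw [h i, h j]

/-- Two conformally related metrics with the same unparametrized timelike geodesics have a
conformal factor with vanishing derivative. -/
theorem fderiv_conformal_factor_eq_zero {g gbar : LorentzMetric M} {F : M → ℝ}
    (hF : ContMDiff 𝓘(ℝ, E4) 𝓘(ℝ, ℝ) ∞ F)
    (hconf : ∀ (p : M) (u v : TangentSpace 𝓘(ℝ, E4) p), gbar.inner p u v = F p * g.inner p u v)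
    (hgeod : ∀ (γ : ℝ → M) (I : Set ℝ), IsCurve γ I → g.IsTimelike γ I →
      g.IsGeodesicUpToReparam γ I → gbar.IsGeodesicUpToReparam γ I)
    {e : OpenPartialHomeomorph M E4} (he : e ∈ IsManifold.maximalAtlas 𝓘(ℝ, E4) ∞ M)
    {y : E4} (hy : y ∈ e.target) : fderiv ℝ (F ∘ e.symm) y = 0 := by
  have hFd : DifferentiableAt ℝ (F ∘ e.symm) y := by
    rw [← mdifferentiableAt_iff_differentiableAt]
    exact (hF.contMDiffAt.comp y
      (contMDiffAt_symm_of_mem_maximalAtlas_top he hy)).mdifferentiableAt (by simp)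
  have hmain {v : E4} (hv : 0 < g.inChart e y v v) :
      ∃ μ : ℝ, ∀ u, fderiv ℝ (F ∘ e.symm) y u * g.inChart e y v v = μ * g.inChart e y v u := by
    obtain ⟨ε, hε, c, w, rfl, rfl, hcs, hcw⟩ := exists_geodesic_coordinates e.open_target
      (g.contDiffOn_inChart he) (g.inChart_isInvertible e he) hy hv
    have h0 : (0 : ℝ) ∈ Ioo (-ε) ε := by simp [hε]
    have hct := fun t ht ↦ (hcw t ht).2.2.1
    have hcurve := isCurve_of_chart he hε hcs hct
    have hg := g.isGeodesic_of_chart he isOpen_Ioo (fun t ht ↦ (hcw t ht).1)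
      (fun t ht ↦ (hcw t ht).2.1) hct
    have htl := g.isTimelike_of_chart he isOpen_Ioo (fun t ht ↦ (hcw t ht).1) hct
      (fun t ht ↦ (hcw t ht).2.2.2)
    obtain ⟨κ, hκ⟩ := (hgeod _ _ hcurve htl
      (hg.isGeodesicUpToReparam hcurve)).exists_acceleration_eq_smul he h0
      (fun t ht ↦ (hcw t ht).1) (hcw 0 h0).2.1 hct
    refine fderiv_conformal_factor (κ := κ) (g.inChart_isInvertible e he _ hy)
      (gbar.inChart_isInvertible e he _ hy)
      (((g.contDiffOn_inChart he).contDiffAt (e.open_target.mem_nhds hy)).differentiableAt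
        (by simp)) hFd (Eventually.of_forall fun z ↦ ?_) ?_
    · ext u v
      exact hconf _ _ _
    · exact (neg_add_eq_iff_eq_add.1 hκ)
  obtain ⟨η, hη⟩ := g.exists_chart_frame he hy
  have h00 : g.inChart e y (η 0) (η 0) = 1 := by simp [hη, lorentzSign]
  have h01 : g.inChart e y (η 0) (η 1) = 0 := by simp [hη]
  have h10 : g.inChart e y (η 1) (η 0) = 0 := by simp [hη]
  have h11 : g.inChart e y (η 1) (η 1) = -1 := by simp [hη, lorentzSign]
  obtain ⟨μ, hμ⟩ := hmain (v := η 0) (by rw [h00]; exact one_pos)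
  -- The coefficient 2 makes this second vector timelike (4 − 1 = 3). Evaluating at η 1, the first
  -- relation gives dF(η 1) = 0, and the second then gives ν = 0.
  have hv : g.inChart e y ((2 : ℝ) • η 0 + η 1) ((2 : ℝ) • η 0 + η 1) = 3 := by
    simp [h00, h01, h10, h11]
    norm_num
  obtain ⟨ν, hν⟩ := hmain (v := (2 : ℝ) • η 0 + η 1) (by rw [hv]; norm_num)
  have h1 := hμ (η 1)
  have h2 := hν (η 1)
  rw [h00, h01] at h1
  rw [hv] at h2
  simp [h01, h11] at h2
  have hν0 : ν = 0 := by linarith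
  ext u
  have h3 := hν u
  rw [hv, hν0] at h3
  simpa using h3

end LorentzMetric

end

end Spacetime

/-! ### From zero derivative to a constant factor -/

theorem mainTheorem9 {M : Type*} [TopologicalSpace M] [T2Space M] [ConnectedSpace M]
    [ChartedSpace Spacetime.E4 M] [IsManifold 𝓘(ℝ, Spacetime.E4) ∞ M]
    (g gbar : Spacetime.LorentzMetric M)
    (Ω : M → ℝ) (hΩ : ContMDiff 𝓘(ℝ, Spacetime.E4) 𝓘(ℝ, ℝ) ∞ Ω)
    (hconf : ∀ (p : M) (u v : TangentSpace 𝓘(ℝ, Spacetime.E4) p),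
      gbar.inner p u v = Ω p ^ 2 * g.inner p u v)
    (hgeod : ∀ (γ : ℝ → M) (I : Set ℝ), Spacetime.IsCurve γ I → g.IsTimelike γ I →
      (gbar.IsGeodesicUpToReparam γ I ↔ g.IsGeodesicUpToReparam γ I)) :
    ∃ c : ℝ, ∀ p : M, Ω p = c := by
  have hne : ∀ p, Ω p ≠ 0 := by
    intro p h0
    obtain ⟨ξ, hξ⟩ := gbar.signature p
    have h := hξ 0 0
    rw [hconf, h0] at h
    simp [Spacetime.lorentzSign] at h
  have hloc : IsLocallyConstant Ω := by
    rw [IsLocallyConstant.iff_eventually_eq]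
    intro p
    have he : chartAt Spacetime.E4 p ∈ IsManifold.maximalAtlas 𝓘(ℝ, Spacetime.E4) ∞ M :=
      IsManifold.chart_mem_maximalAtlas p
    have hp := mem_chart_source Spacetime.E4 p
    generalize chartAt Spacetime.E4 p = e at he hp
    have hd : DifferentiableOn ℝ (Ω ∘ e.symm) e.target := fun y hy ↦ by
      have h := (hΩ.contMDiffAt.comp y
        (Spacetime.contMDiffAt_symm_of_mem_maximalAtlas_top he hy)).mdifferentiableAt (by simp)
      exact (mdifferentiableAt_iff_differentiableAt.1 h).differentiableWithinAt
    -- The derivative of Ω² is 2Ω dΩ, and Ω is nonzero.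
    have hfd : e.target.EqOn (fderiv ℝ (Ω ∘ e.symm)) 0 := fun y hy ↦ by
      have h := Spacetime.LorentzMetric.fderiv_conformal_factor_eq_zero
        (F := fun p ↦ Ω p ^ 2) (hΩ.pow 2) hconf
        (fun γ I h1 h2 h3 ↦ (hgeod γ I h1 h2).2 h3) he hy
      have h2 := ((hd y hy).differentiableAt (e.open_target.mem_nhds hy)).hasFDerivAt.pow 2
      have h3 := h2.fderiv.symm.trans h
      have h4 : (2 : ℝ) * Ω (e.symm y) ≠ 0 := mul_ne_zero two_ne_zero (hne _)
      have h5 : ((2 : ℝ) * Ω (e.symm y)) • fderiv ℝ (Ω ∘ e.symm) y = 0 := by simpa using h3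
      exact (smul_eq_zero.1 h5).resolve_left h4
    -- The chart target need not be connected, so constancy is deduced on a ball inside it.
    obtain ⟨r, hr, hball⟩ := Metric.isOpen_iff.1 e.open_target (e p) (e.map_source hp)
    filter_upwards [(e.continuousAt hp).eventually (Metric.ball_mem_nhds (e p) hr),
      e.open_source.mem_nhds hp] with q hq hqs
    have h := Metric.isOpen_ball.is_const_of_fderiv_eq_zero
      (convex_ball (e p) r).isPreconnected (hd.mono hball) (fun z hz ↦ hfd (hball hz)) hq
      (Metric.mem_ball_self hr)
    simpa [e.left_inv hqs, e.left_inv hp] using h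
  obtain ⟨p₀⟩ := (inferInstance : Nonempty M)
  exact ⟨Ω p₀, fun p ↦ hloc.apply_eq_of_preconnectedSpace p p₀⟩
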